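/- Let $\Sigma_n=(K_n,\sigma,\mathbb F_2^m)$ be a multisigned complete graph: every edge $e$ of $K_n$ carries a label $\sigma(e)\in\mathbb F_2^m$. The multisign of a circle (simple cycle) is the sum of the labels of its edges, and $\eta(x)$ denotes the number of triangles with multisign $x$. Call $\Sigma_n$ a \emph{special case} if, for every choice of $m$ triangles $T_1,\dots,T_m$ of $K_n$ with linearly independent multisigns, three or more of them share a common vertex or form a circle. Here triangles $T_{i_1},\dots,T_{i_k}$ with $k\ge 3$ distinct indices form a circle if there is a circle $C$ in $K_n$ of length $k$ whose edges can be listed as $c_1,\dots,c_k$ with $c_j$ an edge of $T_{i_j}$ for each $j$. Theorem. For every $m\ge 0$ there is an $N$, depending only on $m$, such that the following holds for all $n\ge N$ and all multisigned complete graphs $\Sigma_n=(K_n,\sigma,\mathbb F_2^m)$. Suppose that $\eta(0)\ge\eta(t)$ for all $t\in\mathbb F_2^m$, that there exist $m$ triangles whose multisigns are linearly independent, and that $\Sigma_n$ is not a special case. Then every element of $\mathbb F_2^m$ is the multisign of some Hamiltonian circle of $\Sigma_n$. -/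

import Mathlib

namespace Multisigned

/-- The complete graph `K_n`. -/
abbrev K (n : ℕ) : SimpleGraph (Fin n) := ⊤

/-- A multisigned complete graph `(K_n, σ, F_2^m)`: every edge `s(a, b)` carries a vector of
`F_2^m`. Unordered pairs with `a = b` are not edges, and the values there are never used. -/
abbrev Multisigning (n m : ℕ) : Type := Sym2 (Fin n) → (Fin m → ZMod 2)

/-- The multisign of a finite set of edges (in particular, of a circle): the sum of the labels. -/
def multisign {n m : ℕ} (σ : Multisigning n m) (E : Finset (Sym2 (Fin n))) :
    Fin m → ZMod 2 :=
  ∑ e ∈ E, σ e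

/-- The edges of `K_n` that join two vertices of `T`. A triangle is identified with its set of
three vertices, and these are then its three edges. -/
def triangleEdges {n : ℕ} (T : Finset (Fin n)) : Finset (Sym2 (Fin n)) :=
  T.sym2.filter fun e => ¬ e.IsDiag

/-- The multisign of the triangle with vertex set `T`. -/
def triangleSign {n m : ℕ} (σ : Multisigning n m) (T : Finset (Fin n)) :
    Fin m → ZMod 2 :=
  multisign σ (triangleEdges T)

/-- `η(x)`: the number of triangles of `K_n` with multisign `x`. -/
def eta {n m : ℕ} (σ : Multisigning n m) (x : Fin m → ZMod 2) : ℕ :=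
  (((Finset.univ : Finset (Fin n)).powersetCard 3).filter fun T => triangleSign σ T = x).card

/-- `T 0, …, T (m - 1)` are triangles with linearly independent multisigns. -/
def IndependentTriangles {n m : ℕ} (σ : Multisigning n m) (T : Fin m → Finset (Fin n)) : Prop :=
  (∀ i, (T i).card = 3) ∧ LinearIndependent (ZMod 2) fun i => triangleSign σ (T i)

/-- Three or more of the triangles share a common vertex. -/
def ShareVertex {n m : ℕ} (T : Fin m → Finset (Fin n)) : Prop :=
  ∃ v : Fin n, 3 ≤ (Finset.univ.filter fun i => v ∈ T i).card

/-- Three or more of the triangles form a circle: there is a circle of `K_n` (necessarily with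
at least three edges) whose edges can be taken from pairwise different triangles of the family,
one edge from each. -/
def FormCircle {n m : ℕ} (T : Fin m → Finset (Fin n)) : Prop :=
  ∃ (v : Fin n) (c : (K n).Walk v v), c.IsCycle ∧
    ∃ i : Sym2 (Fin n) → Fin m,
      Set.InjOn i {e | e ∈ c.edges} ∧ ∀ e ∈ c.edges, e ∈ triangleEdges (T (i e))

/-- The special cases: whichever `m` triangles with linearly independent multisigns one takes,
three or more of them share a common vertex or form a circle. -/
def IsSpecial {n m : ℕ} (σ : Multisigning n m) : Prop :=
  ∀ T : Fin m → Finset (Fin n), IndependentTriangles σ T → ShareVertex T ∨ FormCircle T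

/-- The set of all multisigns of Hamiltonian circles. -/
def hamiltonianMultisigns {n m : ℕ} (σ : Multisigning n m) : Set (Fin m → ZMod 2) :=
  {g | ∃ (v : Fin n) (p : (K n).Walk v v),
    p.IsHamiltonianCycle ∧ multisign σ p.edges.toFinset = g}

end Multisigned

/-! Switching labels by a function on the vertices preserves the multisigns of triangles and
circles. A system that is not special has `m` triangles with independent multisigns, no three
sharing a vertex or forming a circle. The determinant is multilinear in its rows, so one edge per
triangle can be chosen with independent labels (`exists_linearIndependent_of_sum`). Every subset of
these edges has maximum degree at most two and no circle, hence splits into disjoint paths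
(`exists_paths_of_choice`).

Because zero is the commonest triangle multisign, some edge `bc` away from these triangles lies in
many zero triangles. Pigeonhole, switching and Ramsey's theorem extract from their apexes a large
set `A` with a constant label `α` inside and label zero towards the vertices of the `m` triangles
(`exists_switch_homogeneous`). Threading the paths through `A` gives a Hamiltonian circle. The
number of `α`-edges depends on the paths, but rerouting next to `bc` corrects its parity, so the
multisign is a fixed constant plus the sum of the chosen labels
(`exists_add_sum_mem_hamiltonianMultisigns`). Subset sums of a basis exhaust the space. -/

namespace Multisigned

/-! ### Paths as vertex lists -/

section Lists

variable {V : Type*}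

/-- The edges joining consecutive vertices of a list. -/
def edgeList : List V → List (Sym2 V)
  | a :: b :: l => s(a, b) :: edgeList (b :: l)
  | _ => []

@[simp] theorem edgeList_nil : edgeList ([] : List V) = [] := rfl

@[simp] theorem edgeList_singleton (a : V) : edgeList [a] = [] := rfl

@[simp] theorem edgeList_cons_cons (a b : V) (l : List V) :
    edgeList (a :: b :: l) = s(a, b) :: edgeList (b :: l) := rfl

theorem edgeList_append_cons (l₁ : List V) (x : V) (l₂ : List V) :
    edgeList (l₁ ++ x :: l₂) = edgeList (l₁ ++ [x]) ++ edgeList (x :: l₂) := by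
  induction l₁ with
  | nil => simp
  | cons a l₁ ih => cases l₁ with
    | nil => simp
    | cons b l₁ => simpa using ih

theorem edgeList_reverse_perm (l : List V) : (edgeList l.reverse).Perm (edgeList l) := by
  induction l with
  | nil => simp
  | cons a l ih => cases l with
    | nil => simp
    | cons b l =>
      have h : (a :: b :: l).reverse = l.reverse ++ b :: [a] := by simp
      rw [h, edgeList_append_cons, edgeList_cons_cons a, ← List.reverse_cons, Sym2.eq_swap]
      simpa using (List.perm_append_singleton _ _).trans (ih.cons _)

theorem mem_of_mem_edgeList {l : List V} {e : Sym2 V} (he : e ∈ edgeList l) {v : V}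
    (hv : v ∈ e) : v ∈ l := by
  induction l with
  | nil => simp at he
  | cons a l ih => cases l with
    | nil => simp at he
    | cons b l =>
      rcases List.mem_cons.1 he with rfl | he
      · rcases Sym2.mem_iff.1 hv with rfl | rfl <;> simp
      · exact List.mem_cons_of_mem _ (ih he)

theorem exists_walk_edges_eq (l : List V) (u v : V) (h : (u :: (l ++ [v])).Nodup) :
    ∃ p : (⊤ : SimpleGraph V).Walk u v,
      p.edges = edgeList (u :: (l ++ [v])) ∧ p.support = u :: (l ++ [v]) := by
  induction l generalizing u with
  | nil =>
    have huv : (⊤ : SimpleGraph V).Adj u v := by simpa using h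
    exact ⟨.cons huv .nil, by simp, by simp⟩
  | cons x l ih =>
    obtain ⟨p, hp, hs⟩ := ih x (List.nodup_cons.1 h).2
    have hux : (⊤ : SimpleGraph V).Adj u x := by
      simp only [List.cons_append, List.nodup_cons, List.mem_cons, not_or] at h
      simpa using h.1.1
    exact ⟨.cons hux p, by simp [hp], by simp [hs]⟩

theorem exists_path_edges_subset {l : List V} (hl : l.Nodup) {u v : V} (hu : u ∈ l)
    (hv : v ∈ l) (huv : u ≠ v) :
    ∃ p : (⊤ : SimpleGraph V).Walk u v, p.IsPath ∧ ∀ e ∈ p.edges, e ∈ edgeList l := by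
  have key : ∀ {u v : V} {p q : List V}, (p ++ u :: q).Nodup → v ∈ q →
      ∃ w : (⊤ : SimpleGraph V).Walk u v, w.IsPath ∧ ∀ e ∈ w.edges, e ∈ edgeList (p ++ u :: q) := by
    intro u v p q hl hv
    obtain ⟨q₁, q₂, rfl⟩ := List.append_of_mem hv
    have hn : (u :: (q₁ ++ [v])).Nodup :=
      hl.sublist ((((List.singleton_sublist.2 (by simp)).append_left q₁).cons_cons u).trans
        (List.sublist_append_right _ _))
    obtain ⟨w, hw, hs⟩ := exists_walk_edges_eq q₁ u v hn
    refine ⟨w, (SimpleGraph.Walk.isPath_def w).2 (hs ▸ hn), fun e he => ?_⟩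
    rw [edgeList_append_cons, ← List.cons_append, edgeList_append_cons (u :: q₁)]
    rw [hw] at he
    simp [he]
  obtain ⟨p, q, rfl⟩ := List.append_of_mem hu
  rcases List.mem_append.1 hv with h | h
  · obtain ⟨p₁, p₂, rfl⟩ := List.append_of_mem h
    have e : p₁ ++ v :: p₂ ++ u :: q = p₁ ++ v :: (p₂ ++ u :: q) := by simp
    rw [e] at hl ⊢
    obtain ⟨w, hw, hs⟩ := key (u := v) (v := u) hl (by simp)
    exact ⟨w.reverse, hw.reverse, fun e he => hs e (by simpa using he)⟩
  · exact key hl (by simpa [huv.symm] using h)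

/-- The hypothesis `h` makes `u` an end of the path: an interior vertex would have equal neighbours
on both sides, which a list without repetitions excludes. If `u` comes first, reversal moves it to
the end. -/
theorem exists_perm_ending_at {l : List V} (hl : l.Nodup) {u : V} (hu : u ∈ l)
    (h : ∀ x y, s(x, u) ∈ edgeList l → s(u, y) ∈ edgeList l → x = y) :
    ∃ q : List V, (q ++ [u]).Perm l ∧ (edgeList (q ++ [u])).Perm (edgeList l) := by
  obtain ⟨p, q, rfl⟩ := List.append_of_mem hu
  rcases p.eq_nil_or_concat with rfl | ⟨p, x, rfl⟩
  · refine ⟨q.reverse, ?_, ?_⟩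
    · rw [← List.reverse_cons]; exact List.reverse_perm _
    · rw [← List.reverse_cons]; exact edgeList_reverse_perm _
  · cases q with
    | nil => exact ⟨_, .refl _, .refl _⟩
    | cons y q =>
      have hE : edgeList (p.concat x ++ u :: y :: q) =
          edgeList (p ++ [x]) ++ s(x, u) :: s(u, y) :: edgeList (y :: q) := by
        rw [List.concat_eq_append, List.append_assoc, List.singleton_append,
          edgeList_append_cons, edgeList_cons_cons, edgeList_cons_cons]
      obtain rfl := h x y (by rw [hE]; simp) (by rw [hE]; simp)
      simp [List.nodup_append] at hl

end Lists

/-! ### Linear forests -/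

section LinearForest

variable {V : Type*} [DecidableEq V]

/-- A finite set of edges with maximum degree at most two and without circles is the edge set of
a disjoint union of paths. -/
theorem exists_paths_of_linearForest (X : Finset V) (E : Finset (Sym2 V))
    (hdiag : ∀ e ∈ E, ¬ e.IsDiag) (hX : ∀ e ∈ E, ∀ v ∈ e, v ∈ X)
    (hdeg : ∀ v, (E.filter fun e => v ∈ e).card ≤ 2)
    (hcyc : ∀ (v : V) (c : (⊤ : SimpleGraph V).Walk v v), c.IsCycle → ∃ e ∈ c.edges, e ∉ E) :
    ∃ L : List (List V), (∀ P ∈ L, P ≠ []) ∧ L.flatten.Nodup ∧ (∀ v, v ∈ L.flatten ↔ v ∈ X) ∧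
      (L.flatMap edgeList).Perm E.toList := by
  induction E using Finset.induction_on with
  | empty =>
    have h : (X.toList.map fun x => [x]).flatten = X.toList := by
      induction X.toList <;> simp_all
    refine ⟨X.toList.map fun x => [x], by simp, by rw [h]; exact X.nodup_toList,
      by simp, ?_⟩
    induction X.toList <;> simp_all
  | insert e E he ih =>
    obtain ⟨L, hne, hnd, hmem, hperm⟩ := ih
      (fun e h => hdiag e (Finset.mem_insert_of_mem h))
      (fun e h => hX e (Finset.mem_insert_of_mem h))
      (fun v => (Finset.card_le_card (Finset.filter_subset_filter _
        (Finset.subset_insert _ _))).trans (hdeg v))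
      (fun v c hc => by
        obtain ⟨e', h1, h2⟩ := hcyc v c hc
        exact ⟨e', h1, fun h => h2 (Finset.mem_insert_of_mem h)⟩)
    induction e using Sym2.ind with | _ u v => ?_
    have huv : u ≠ v := by simpa using hdiag _ (Finset.mem_insert_self _ _)
    have hmemE : ∀ P ∈ L, ∀ e ∈ edgeList P, e ∈ E := fun P hP e h =>
      Finset.mem_toList.1 (hperm.subset (List.mem_flatMap.2 ⟨P, hP, h⟩))
    have hndP : ∀ P ∈ L, P.Nodup := fun P hP => (List.nodup_flatten.1 hnd).1 P hP
    obtain ⟨P, hP, huP⟩ := List.mem_flatten.1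
      ((hmem u).2 (hX _ (Finset.mem_insert_self _ _) u (by simp)))
    obtain ⟨Q, hQ, hvQ⟩ := List.mem_flatten.1
      ((hmem v).2 (hX _ (Finset.mem_insert_self _ _) v (by simp)))
    -- Otherwise the segment of the path between `u` and `v` and the new edge would close a circle.
    have hPQ : Q ≠ P := by
      rintro rfl
      obtain ⟨p, hp, hpe⟩ := exists_path_edges_subset (hndP _ hP) huP hvQ huv
      have hadj : (⊤ : SimpleGraph V).Adj v u := by simpa using huv.symm
      obtain ⟨e', h1, h2⟩ := hcyc v (.cons hadj p)
        ((SimpleGraph.Walk.cons_isCycle_iff p hadj).2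
          ⟨hp, fun h => he (Sym2.eq_swap ▸ hmemE _ hP _ (hpe _ h))⟩)
      rw [SimpleGraph.Walk.edges_cons, List.mem_cons] at h1
      rcases h1 with rfl | h1
      · exact h2 (Sym2.eq_swap ▸ Finset.mem_insert_self _ _)
      · exact h2 (Finset.mem_insert_of_mem (hmemE _ hP _ (hpe _ h1)))
    -- The new edge uses up one of the two degrees at `u` and at `v`, so each is an end of its old
    -- path, and the two paths can be glued there.
    have hend : ∀ w ∈ s(u, v), ∀ R ∈ L, ∀ x y, s(x, w) ∈ edgeList R → s(w, y) ∈ edgeList R →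
        x = y := by
      intro w hw R hR x y hx hy
      by_contra hxy
      have hsub : {s(u, v), s(x, w), s(w, y)} ⊆ (insert s(u, v) E).filter fun e => w ∈ e := by
        intro e'
        simp only [Finset.mem_insert, Finset.mem_singleton, Finset.mem_filter]
        rintro (rfl | rfl | rfl)
        · exact ⟨.inl rfl, hw⟩
        · exact ⟨.inr (hmemE R hR _ hx), by simp⟩
        · exact ⟨.inr (hmemE R hR _ hy), by simp⟩
      have h1 : s(u, v) ≠ s(x, w) := fun h => he (h ▸ hmemE R hR _ hx)
      have h2 : s(u, v) ≠ s(w, y) := fun h => he (h ▸ hmemE R hR _ hy)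
      have h3 : s(x, w) ≠ s(w, y) := by
        rw [Sym2.eq_swap]
        exact fun h => hxy (Sym2.congr_right.1 h)
      have := (Finset.card_le_card hsub).trans (hdeg w)
      rw [Finset.card_eq_three.2 ⟨_, _, _, h1, h2, h3, rfl⟩] at this
      omega
    obtain ⟨L', hL'⟩ : ∃ L', L.Perm (P :: Q :: L') := by
      obtain ⟨s, t, rfl⟩ := List.append_of_mem hP
      have hQ' : Q ∈ s ++ t := by simpa [hPQ] using hQ
      obtain ⟨s', t', hst⟩ := List.append_of_mem hQ'
      exact ⟨s' ++ t', List.perm_middle.trans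
        (List.Perm.cons _ (hst ▸ List.perm_middle))⟩
    obtain ⟨p, hp1, hp2⟩ := exists_perm_ending_at (hndP P hP) huP (hend u (by simp) P hP)
    obtain ⟨q, hq1, hq2⟩ := exists_perm_ending_at (hndP Q hQ) hvQ (hend v (by simp) Q hQ)
    have hq3 : (v :: q.reverse).Perm Q := by
      have := (List.reverse_perm (q ++ [v])).trans hq1
      simpa using this
    have hq4 : (edgeList (v :: q.reverse)).Perm (edgeList Q) := by
      have := (edgeList_reverse_perm (q ++ [v])).trans hq2
      simpa using this
    have hflat : ((p ++ u :: v :: q.reverse) :: L').flatten.Perm L.flatten := by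
      refine List.Perm.trans ?_ hL'.flatten.symm
      have : p ++ u :: v :: q.reverse = (p ++ [u]) ++ (v :: q.reverse) := by simp
      rw [List.flatten_cons, this, List.flatten_cons, List.flatten_cons, ← List.append_assoc P]
      exact (hp1.append hq3).append_right _
    refine ⟨(p ++ u :: v :: q.reverse) :: L', ?_, hflat.nodup_iff.2 hnd,
      fun w => hflat.mem_iff.trans (hmem w), ?_⟩
    · intro R hR
      rcases List.mem_cons.1 hR with rfl | hR
      · simp
      · exact hne R (hL'.mem_iff.2 (by simp [hR]))
    · refine List.Perm.trans ?_ (Finset.toList_insert he).symm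
      refine List.Perm.trans ?_ ((hL'.flatMap_right edgeList).symm.trans hperm |>.cons _)
      rw [List.flatMap_cons, edgeList_append_cons, edgeList_cons_cons, List.flatMap_cons,
        List.flatMap_cons, List.append_assoc, List.cons_append]
      refine List.perm_middle.trans (List.Perm.cons _ ?_)
      exact hp2.append (hq4.append_right _)

end LinearForest

/-! ### Ramsey's theorem and a choice of independent vectors -/

/-- Ramsey's theorem for graphs, with finitely many colours and a prescribed size for each. -/
theorem exists_homogeneous_of_sum {C : Type*} [Fintype C] [Nonempty C] [DecidableEq C] (s : ℕ)
    (k : C → ℕ) (hk : ∑ c, k c = s) :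
    ∃ M : ℕ, ∀ {V : Type} [DecidableEq V] (A : Finset V) (col : Sym2 V → C), M ≤ A.card →
      ∃ c, ∃ B ⊆ A, k c ≤ B.card ∧ ∀ x ∈ B, ∀ y ∈ B, x ≠ y → col s(x, y) = c := by
  induction s generalizing k with
  | zero =>
    refine ⟨0, fun A col _ => ⟨Classical.arbitrary C, ∅, by simp, ?_, by simp⟩⟩
    have := (Finset.sum_eq_zero_iff.1 hk) (Classical.arbitrary C) (Finset.mem_univ _)
    omega
  | succ s ih =>
    by_cases h0 : ∃ c, k c = 0
    · obtain ⟨c, hc⟩ := h0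
      exact ⟨0, fun A col _ => ⟨c, ∅, by simp, by omega, by simp⟩⟩
    push Not at h0
    have hsum : ∀ c, ∑ d, Function.update k c (k c - 1) d = s := by
      intro c
      rw [Finset.sum_update_of_mem (Finset.mem_univ c)]
      rw [← Finset.add_sum_erase _ _ (Finset.mem_univ c)] at hk
      have := h0 c
      rw [Finset.sdiff_singleton_eq_erase]
      omega
    choose M hM using fun c => ih _ (hsum c)
    -- One vertex `v`, plus enough others that some colour class `c` at `v` has at least `M c`
    -- members. In that class the demand for `c` is lowered by one, since `v` itself can be added.
    refine ⟨1 + ∑ c, M c, fun {V} _ A col hA => ?_⟩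
    obtain ⟨v, hv⟩ : A.Nonempty := Finset.card_pos.1 (by omega)
    have hcard : ∑ c, ((A.erase v).filter fun a => col s(v, a) = c).card = (A.erase v).card :=
      (Finset.card_eq_sum_card_fiberwise fun _ _ => Finset.mem_univ _).symm
    obtain ⟨c, -, hc⟩ : ∃ c ∈ Finset.univ, M c ≤
        ((A.erase v).filter fun a => col s(v, a) = c).card := by
      refine Finset.exists_le_of_sum_le Finset.univ_nonempty ?_
      rw [hcard, Finset.card_erase_of_mem hv]
      omega
    obtain ⟨d, B, hB, hd, hBc⟩ := hM c _ col hc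
    have hBA : B ⊆ A := fun x hx =>
      Finset.mem_of_mem_erase (Finset.mem_of_mem_filter _ (hB hx))
    by_cases hdc : d = c
    · subst hdc
      have hvB : v ∉ B := fun h => by simpa using hB h
      have hcol : ∀ x ∈ B, col s(v, x) = d := fun x hx => (Finset.mem_filter.1 (hB hx)).2
      refine ⟨d, insert v B, Finset.insert_subset hv hBA, ?_, ?_⟩
      · rw [Finset.card_insert_of_notMem hvB]
        rw [Function.update_self] at hd
        omega
      · intro x hx y hy hxy
        rcases Finset.mem_insert.1 hx with rfl | hx' <;>
          rcases Finset.mem_insert.1 hy with rfl | hy'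
        · exact absurd rfl hxy
        · exact hcol y hy'
        · rw [Sym2.eq_swap]; exact hcol x hx'
        · exact hBc x hx' y hy' hxy
    · rw [Function.update_of_ne hdc] at hd
      exact ⟨d, B, hBA, hd, hBc⟩

/-- If the sums of the vectors over some index sets are linearly independent, then so is some
choice of one vector from each index set. -/
theorem exists_linearIndependent_of_sum {K ι : Type*} [Field K] {m : ℕ}
    (S : Fin m → Finset ι) (w : ι → Fin m → K)
    (h : LinearIndependent K fun i => ∑ e ∈ S i, w e) :
    ∃ r : Fin m → ι, (∀ i, r i ∈ S i) ∧ LinearIndependent K fun i => w (r i) := by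
  classical
  have hdet : ∀ u : Fin m → Fin m → K,
      LinearIndependent K u ↔ Matrix.detRowAlternating.toMultilinearMap u ≠ 0 := by
    intro u
    have := Matrix.linearIndependent_rows_iff_isUnit (A := Matrix.of u)
    rw [Matrix.isUnit_iff_isUnit_det, isUnit_iff_ne_zero] at this
    exact this
  -- The nonzero determinant expands into a sum of determinants over all choices, so some term is
  -- nonzero.
  rw [hdet, MultilinearMap.map_sum_finset] at h
  obtain ⟨r, hr, hne⟩ := Finset.exists_ne_zero_of_sum_ne_zero h
  exact ⟨r, Fintype.mem_piFinset.1 hr, (hdet _).2 hne⟩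

/-! ### Counting triangles of multisign zero -/

theorem triangleEdges_triple {n : ℕ} {a b c : Fin n} (hab : a ≠ b) (hac : a ≠ c) (hbc : b ≠ c) :
    triangleEdges {a, b, c} = {s(a, b), s(a, c), s(b, c)} := by
  ext e
  induction e using Sym2.ind with | _ x y => ?_
  simp only [triangleEdges, Finset.mem_filter, Finset.mk_mem_sym2_iff, Finset.mem_insert,
    Finset.mem_singleton, Sym2.mk_isDiag_iff, Sym2.eq_iff]
  grind

theorem triangleSign_triple {n m : ℕ} (σ : Multisigning n m) {a b c : Fin n} (hab : a ≠ b)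
    (hac : a ≠ c) (hbc : b ≠ c) :
    triangleSign σ {a, b, c} = σ s(a, b) + σ s(a, c) + σ s(b, c) := by
  rw [triangleSign, multisign, triangleEdges_triple hab hac hbc, Finset.sum_insert,
    Finset.sum_insert, Finset.sum_singleton, add_assoc]
  · simp only [Finset.mem_singleton, Sym2.eq_iff]; grind
  · simp only [Finset.mem_insert, Finset.mem_singleton, Sym2.eq_iff]; grind

theorem sum_eta {n m : ℕ} (σ : Multisigning n m) : ∑ t, eta σ t = n.choose 3 := by
  have := Finset.card_eq_sum_card_fiberwise (s := (Finset.univ : Finset (Fin n)).powersetCard 3)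
    (t := Finset.univ) (f := triangleSign σ) fun _ _ => Finset.mem_coe.2 (Finset.mem_univ _)
  rw [Finset.card_powersetCard, Finset.card_univ, Fintype.card_fin] at this
  exact this.symm

theorem mul_sq_lt_choose_three {K n : ℕ} (hn : 12 * K + 3 ≤ n) : K * n ^ 2 < n.choose 3 := by
  obtain ⟨j, rfl⟩ : ∃ j, n = j + 2 := ⟨n - 2, by omega⟩
  have h := Nat.descFactorial_eq_factorial_mul_choose (j + 2) 3
  have h' : (j + 2).descFactorial 3 = (j + 2) * ((j + 1) * j) := by
    simp [Nat.descFactorial]; ring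
  rw [h'] at h
  norm_num [Nat.factorial] at h
  -- With `j + 2 ≤ 2 * (j + 1)`, this yields `6 * K * (j + 2) ^ 2 < (j + 2) * (j + 1) * j`.
  have hj : (12 * K + 1) * (j + 1) ≤ j * (j + 1) := Nat.mul_le_mul_right _ (by omega)
  nlinarith

/-- If zero is the commonest multisign of a triangle, then every small set of vertices is disjoint
from some edge that lies in many triangles of multisign zero, even outside that set. -/
theorem exists_edge_in_many_zero_triangles (m k M : ℕ) :
    ∃ N : ℕ, ∀ n : ℕ, N ≤ n → ∀ σ : Multisigning n m, (∀ t, eta σ t ≤ eta σ 0) →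
      ∀ X : Finset (Fin n), X.card ≤ k → ∃ b c, b ≠ c ∧ b ∉ X ∧ c ∉ X ∧
        M ≤ (Finset.univ.filter fun a =>
          a ∉ X ∧ a ≠ b ∧ a ≠ c ∧ triangleSign σ {a, b, c} = 0).card := by
  refine ⟨12 * (2 ^ m * (k + M)) + 3, fun n hn σ hη X hX => ?_⟩
  by_contra! hcon
  set F : Fin n → Fin n → Finset (Fin n) := fun b c => Finset.univ.filter fun a =>
    a ∉ X ∧ a ≠ b ∧ a ≠ c ∧ triangleSign σ {a, b, c} = 0 with hF
  -- Every zero triangle is a pair `p` plus a third vertex that lies in `X` or, if `p` avoids `X`,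
  -- in the small set `F`. So `η(0)` is at most quadratic in `n`, while being the largest of `2 ^ m`
  -- counts forces cubic growth.
  set S : Fin n × Fin n → Finset (Finset (Fin n)) := fun p =>
    (X ∪ if p.1 ≠ p.2 ∧ p.1 ∉ X ∧ p.2 ∉ X then F p.1 p.2 else ∅).image
      fun a => {a, p.1, p.2} with hS
  have hcard : ∀ p ∈ Finset.univ, (S p).card ≤ k + M := by
    intro p _
    refine Finset.card_image_le.trans ((Finset.card_union_le _ _).trans (add_le_add hX ?_))
    split_ifs with h
    · exact (hcon p.1 p.2 h.1 h.2.1 h.2.2).le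
    · simp
  have hsub : (((Finset.univ : Finset (Fin n)).powersetCard 3).filter
      fun T => triangleSign σ T = 0) ⊆ Finset.univ.biUnion S := by
    intro T hT
    rw [Finset.mem_filter, Finset.mem_powersetCard] at hT
    obtain ⟨⟨-, h3⟩, h0⟩ := hT
    obtain ⟨x, y, z, hxy, hxz, hyz, rfl⟩ := Finset.card_eq_three.1 h3
    rw [Finset.mem_biUnion]
    by_cases hx : x ∈ X
    · exact ⟨(y, z), Finset.mem_univ _,
        Finset.mem_image.2 ⟨x, Finset.mem_union_left _ hx, rfl⟩⟩
    by_cases hy : y ∈ X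
    · exact ⟨(x, z), Finset.mem_univ _,
        Finset.mem_image.2 ⟨y, Finset.mem_union_left _ hy, Finset.insert_comm _ _ _⟩⟩
    by_cases hz : z ∈ X
    · refine ⟨(x, y), Finset.mem_univ _,
        Finset.mem_image.2 ⟨z, Finset.mem_union_left _ hz, ?_⟩⟩
      ext; simp; tauto
    · refine ⟨(y, z), Finset.mem_univ _,
        Finset.mem_image.2 ⟨x, Finset.mem_union_right _ ?_, rfl⟩⟩
      simp only [ne_eq, hyz, not_false_eq_true, hy, hz, and_self, if_true]
      simp [hF, hx, hxy, hxz, h0]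
  have h1 : eta σ 0 ≤ n ^ 2 * (k + M) := by
    refine (Finset.card_le_card hsub).trans ((Finset.card_biUnion_le_card_mul _ _ _ hcard).trans ?_)
    simp [sq]
  have h2 : n.choose 3 ≤ 2 ^ m * (n ^ 2 * (k + M)) := by
    rw [← sum_eta σ]
    refine (Finset.sum_le_card_nsmul _ _ _ fun t _ => (hη t).trans h1).trans ?_
    simp
  have h3 := mul_sq_lt_choose_three hn
  rw [show 2 ^ m * (n ^ 2 * (k + M)) = 2 ^ m * (k + M) * n ^ 2 by ring] at h2
  omega

/-! ### Switching -/

theorem vector_add_self {m : ℕ} (x : Fin m → ZMod 2) : x + x = 0 :=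
  funext fun i => CharTwo.add_self_eq_zero (x i)

/-- The multisigning obtained from `σ` by switching with the function `f`. -/
def switch {n m : ℕ} (f : Fin n → Fin m → ZMod 2) (σ : Multisigning n m) : Multisigning n m :=
  fun e => σ e + e.lift ⟨fun u v => f u + f v, fun _ _ => add_comm _ _⟩

@[simp] theorem switch_mk {n m : ℕ} (f : Fin n → Fin m → ZMod 2) (σ : Multisigning n m)
    (u v : Fin n) : switch f σ s(u, v) = σ s(u, v) + (f u + f v) := rfl

theorem triangleSign_switch {n m : ℕ} (f : Fin n → Fin m → ZMod 2) (σ : Multisigning n m)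
    {T : Finset (Fin n)} (hT : T.card = 3) : triangleSign (switch f σ) T = triangleSign σ T := by
  obtain ⟨x, y, z, hxy, hxz, hyz, rfl⟩ := Finset.card_eq_three.1 hT
  rw [triangleSign_triple _ hxy hxz hyz, triangleSign_triple _ hxy hxz hyz]
  simp only [switch_mk]
  linear_combination vector_add_self (f x) + vector_add_self (f y) + vector_add_self (f z)

/-! ### Hamiltonian circles from vertex lists -/

section Weight

variable {n m : ℕ}

/-- The sum of the labels of the edges between consecutive vertices of a list. -/
def weight (σ : Multisigning n m) (l : List (Fin n)) : Fin m → ZMod 2 :=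
  ((edgeList l).map σ).sum

@[simp] theorem weight_singleton (σ : Multisigning n m) (a : Fin n) : weight σ [a] = 0 := rfl

@[simp] theorem weight_cons_cons (σ : Multisigning n m) (a b : Fin n) (l : List (Fin n)) :
    weight σ (a :: b :: l) = σ s(a, b) + weight σ (b :: l) := by
  simp [weight]

theorem weight_append_cons (σ : Multisigning n m) (l₁ : List (Fin n)) (x : Fin n)
    (l₂ : List (Fin n)) : weight σ (l₁ ++ x :: l₂) = weight σ (l₁ ++ [x]) + weight σ (x :: l₂) := by
  simp only [weight]
  rw [edgeList_append_cons, List.map_append, List.sum_append]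

theorem weight_mem_hamiltonianMultisigns (σ : Multisigning n m) {v : Fin n} {l : List (Fin n)}
    (hnd : (v :: l).Nodup) (hall : ∀ x, x ∈ v :: l) (hlen : 2 ≤ l.length) :
    weight σ (v :: (l ++ [v])) ∈ hamiltonianMultisigns σ := by
  obtain ⟨x, y, l, rfl⟩ : ∃ x y l', l = x :: y :: l' := by
    match l, hlen with
    | x :: y :: l', _ => exact ⟨x, y, l', rfl⟩
  have hperm : (x :: ((y :: l) ++ [v])).Perm (v :: x :: y :: l) :=
    List.perm_append_singleton v (x :: y :: l)
  have hnd' := hperm.nodup_iff.2 hnd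
  obtain ⟨p, hpe, hps⟩ := exists_walk_edges_eq (y :: l) x v hnd'
  have hvx : v ≠ x := by
    rintro rfl
    simp at hnd
  have hvy : v ≠ y := by
    rintro rfl
    simp at hnd
  have hadj : (K n).Adj v x := by simpa using hvx
  have hcyc : (SimpleGraph.Walk.cons hadj p).IsCycle := by
    refine (SimpleGraph.Walk.cons_isCycle_iff p hadj).2
      ⟨(SimpleGraph.Walk.isPath_def p).2 (hps ▸ hnd'), fun h => ?_⟩
    rw [hpe, List.cons_append, edgeList_cons_cons, List.mem_cons] at h
    rcases h with h | h
    · rw [Sym2.eq_swap] at h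
      exact hvy (Sym2.congr_right.1 h)
    · exact (List.nodup_cons.1 hnd').1 (mem_of_mem_edgeList h (by simp))
  refine ⟨v, .cons hadj p,
    SimpleGraph.Walk.isHamiltonianCycle_iff_isCycle_and_length_eq.2 ⟨hcyc, ?_⟩, ?_⟩
  · have h1 := SimpleGraph.Walk.length_support p
    have h2 : (v :: x :: y :: l).toFinset = Finset.univ := by
      ext z; simpa using hall z
    have h3 := List.toFinset_card_of_nodup hnd
    rw [h2, Finset.card_univ] at h3
    rw [hps, hperm.length_eq] at h1
    rw [SimpleGraph.Walk.length_cons, h3, h1]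
  · rw [multisign, List.sum_toFinset _ hcyc.edges_nodup, SimpleGraph.Walk.edges_cons, hpe]
    rfl

end Weight

/-! ### Threading paths through a set -/

section Interleave

variable {V : Type*}

/-- Concatenate the lists in the first argument, with one element of the second argument after
each of them, followed by the rest of the second argument. -/
def interleave : List (List V) → List V → List V
  | P :: L, a :: as => P ++ a :: interleave L as
  | _, as => as

@[simp] theorem interleave_nil (as : List V) : interleave [] as = as := by
  simp [interleave]

@[simp] theorem interleave_cons_cons (P : List V) (L : List (List V)) (a : V) (as : List V) :
    interleave (P :: L) (a :: as) = P ++ a :: interleave L as := by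
  simp [interleave]

theorem interleave_perm (L : List (List V)) (as : List V) (h : L.length ≤ as.length) :
    (interleave L as).Perm (L.flatten ++ as) := by
  induction L generalizing as with
  | nil => simp
  | cons P L ih => cases as with
    | nil => simp at h
    | cons a as =>
      rw [interleave_cons_cons, List.flatten_cons, List.append_assoc]
      refine List.Perm.append_left _ ?_
      exact ((ih as (by simpa using h)).cons a).trans List.perm_middle.symm

end Interleave

/-! ### Joining paths at constant cost -/

section Structure

variable {n m : ℕ}

theorem weight_all_mem {σ : Multisigning n m} {A : Finset (Fin n)} {α : Fin m → ZMod 2}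
    (hA : ∀ x ∈ A, ∀ y ∈ A, x ≠ y → σ s(x, y) = α) {l : List (Fin n)} (hl : ∀ x ∈ l, x ∈ A)
    (hnd : l.Nodup) : ∃ k : ℕ, weight σ l = k • α := by
  induction l with
  | nil => exact ⟨0, by simp [weight]⟩
  | cons a l ih => cases l with
    | nil => exact ⟨0, by simp⟩
    | cons b l =>
      obtain ⟨k, hk⟩ := ih (fun x hx => hl x (List.mem_cons_of_mem _ hx)) hnd.of_cons
      refine ⟨k + 1, ?_⟩
      rw [weight_cons_cons, hk, hA a (hl a (by simp)) b (hl b (by simp)), add_smul, one_smul,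
        add_comm]
      rintro rfl
      simp at hnd

theorem weight_cons_append_singleton {σ : Multisigning n m} {P : List (Fin n)} (hP : P ≠ [])
    {a b : Fin n} (ha : ∀ x ∈ P, σ s(x, a) = 0) (hb : ∀ x ∈ P, σ s(x, b) = 0) :
    weight σ (a :: (P ++ [b])) = weight σ P := by
  obtain ⟨x, P, rfl⟩ := List.exists_cons_of_ne_nil hP
  rw [List.cons_append, weight_cons_cons, Sym2.eq_swap, ha x (by simp), zero_add,
    ← List.cons_append]
  rcases List.eq_nil_or_concat (x :: P) with h | ⟨Q, y, h⟩
  · simp at h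
  · rw [h, List.concat_eq_append, List.append_assoc, List.singleton_append, weight_append_cons,
      weight_cons_cons, hb y (by rw [h]; simp)]
    simp

/-- The edges joining a path to `A` have label zero, so apart from the paths only edges inside `A`
contribute. Their number `k` stays unspecified because only its parity matters. -/
theorem weight_interleave {σ : Multisigning n m} {A : Finset (Fin n)}
    {α : Fin m → ZMod 2} (hA : ∀ x ∈ A, ∀ y ∈ A, x ≠ y → σ s(x, y) = α)
    (L : List (List (Fin n))) (hL : ∀ P ∈ L, P ≠ [])
    (hXA : ∀ P ∈ L, ∀ x ∈ P, ∀ a ∈ A, σ s(x, a) = 0) (a : Fin n) (as : List (Fin n)) (z : Fin n)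
    (hnd : (a :: (as ++ [z])).Nodup) (hmem : ∀ x ∈ a :: (as ++ [z]), x ∈ A)
    (hlen : L.length ≤ as.length) :
    ∃ k : ℕ, weight σ (a :: (interleave L as ++ [z])) = (L.map (weight σ)).sum + k • α := by
  induction L generalizing a as with
  | nil => simpa using weight_all_mem hA hmem hnd
  | cons P L ih => cases as with
    | nil => simp at hlen
    | cons a' as =>
      obtain ⟨k, hk⟩ := ih (fun Q hQ => hL Q (List.mem_cons_of_mem _ hQ))
        (fun Q hQ => hXA Q (List.mem_cons_of_mem _ hQ)) a' as
        (List.nodup_cons.1 hnd).2 (fun x hx => hmem x (List.mem_cons_of_mem _ hx))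
        (by simpa using hlen)
      refine ⟨k, ?_⟩
      rw [interleave_cons_cons, List.append_assoc, List.cons_append, ← List.cons_append,
        weight_append_cons, hk, List.cons_append,
        weight_cons_append_singleton (hL P (by simp))
          (fun x hx => hXA P (by simp) x hx a (hmem a (by simp)))
          (fun x hx => hXA P (by simp) x hx a' (hmem a' (by simp))),
        List.map_cons, List.sum_cons, add_assoc]

/-- A large homogeneous set `A`, whose edges to `X` and to `b` have label zero, allows us to join
any system of disjoint paths covering `X` to a Hamiltonian circle at a constant cost. -/
theorem exists_add_sum_mem_hamiltonianMultisigns (σ : Multisigning n m) (X A : Finset (Fin n))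
    (b c : Fin n) (α : Fin m → ZMod 2) (hbc : b ≠ c) (hbX : b ∉ X) (hcX : c ∉ X) (hbA : b ∉ A)
    (hcA : c ∉ A) (hdisj : Disjoint X A) (hcard : X.card + 3 ≤ A.card)
    (hA : ∀ x ∈ A, ∀ y ∈ A, x ≠ y → σ s(x, y) = α) (hXA : ∀ x ∈ X, ∀ a ∈ A, σ s(x, a) = 0)
    (hAb : ∀ a ∈ A, σ s(a, b) = 0) (hAc : ∀ a ∈ A, σ s(a, c) = σ s(b, c)) :
    ∃ d : Fin m → ZMod 2, ∀ L : List (List (Fin n)), (∀ P ∈ L, P ≠ []) → L.flatten.Nodup →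
      (∀ v, v ∈ L.flatten ↔ v ∈ X) → d + (L.map (weight σ)).sum ∈ hamiltonianMultisigns σ := by
  obtain ⟨a, a', a₀, as, hAl⟩ : ∃ a a' a₀ as, A.toList = a :: a' :: a₀ :: as := by
    have : 3 ≤ A.toList.length := by rw [Finset.length_toList]; omega
    match A.toList, this with
    | a :: a' :: a₀ :: as, _ => exact ⟨a, a', a₀, as, rfl⟩
  have hmemA : ∀ x, x ∈ A ↔ x = a ∨ x = a' ∨ x = a₀ ∨ x ∈ as := fun x => by
    rw [← Finset.mem_toList, hAl]; simp
  have hndA : (a :: a' :: a₀ :: as).Nodup := hAl ▸ A.nodup_toList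
  have haA : a ∈ A := (hmemA a).2 (.inl rfl)
  have ha'A : a' ∈ A := (hmemA a').2 (.inr (.inl rfl))
  have haa' : a ≠ a' := by
    rintro rfl
    simp at hndA
  -- All remaining vertices are visited in one stretch from `c` to `a₀`, whose weight does not
  -- depend on the paths.
  set R : List (Fin n) := (Finset.univ \ (X ∪ A ∪ {b, c})).toList with hR
  have hRmem : ∀ x, x ∈ R ↔ x ∉ X ∧ x ∉ A ∧ x ≠ b ∧ x ≠ c := fun x => by
    simp [hR]; tauto
  have hRnd : R.Nodup := Finset.nodup_toList _
  refine ⟨weight σ (c :: (R ++ [a₀])) + weight σ [a, a', b, c], fun L hL hLnd hLX => ?_⟩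
  have hlen : L.length ≤ as.length := by
    have h1 : L.length ≤ L.flatten.length := by
      clear hLnd hLX
      induction L with
      | nil => simp
      | cons P L ih =>
        have := List.length_pos_iff.2 (hL P (by simp))
        have := ih fun Q hQ => hL Q (List.mem_cons_of_mem _ hQ)
        rw [List.flatten_cons, List.length_append, List.length_cons]
        omega
    have h2 : L.flatten.length = X.card := by
      rw [← List.toFinset_card_of_nodup hLnd]
      congr 1
      ext x
      rw [List.mem_toFinset, hLX]
    have h3 : A.card = as.length + 3 := by
      rw [← Finset.length_toList, hAl]; simp
    omega
  -- The order of `a'` and `b` between `a` and `c` stays free: the two routes differ in weight by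
  -- exactly `α`.
  have hmain : ∀ t : List (Fin n), t.Perm [a', b] →
      weight σ (c :: (R ++ a₀ :: (interleave L as ++ a :: (t ++ [c])))) ∈
        hamiltonianMultisigns σ := by
    intro t ht
    have hperm : (R ++ a₀ :: (interleave L as ++ a :: t)).Perm
        (R ++ a₀ :: ((L.flatten ++ as) ++ a :: [a', b])) :=
      List.Perm.append_left _ (((interleave_perm L as hlen).append (ht.cons a)).cons a₀)
    have hmemt : ∀ x, x ∈ R ++ a₀ :: (interleave L as ++ a :: t) ↔
        x ∈ R ∨ x ∈ X ∨ x ∈ A ∨ x = b := fun x => by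
      rw [hperm.mem_iff]
      simp only [List.mem_append, List.mem_cons, hLX, hmemA, List.not_mem_nil]
      tauto
    have := weight_mem_hamiltonianMultisigns σ (v := c)
      (l := R ++ a₀ :: (interleave L as ++ a :: t)) ?_ ?_ ?_
    · simpa using this
    · rw [List.nodup_cons, hmemt, hRmem]
      refine ⟨by tauto, hperm.nodup_iff.2 ?_⟩
      have hp : (R ++ a₀ :: ((L.flatten ++ as) ++ a :: [a', b])).Perm
          (R ++ (L.flatten ++ (b :: (a :: a' :: a₀ :: as)))) := by
        refine List.Perm.append_left _ ?_
        classical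
        rw [List.perm_iff_count]
        intro x
        simp only [List.count_cons, List.count_append, List.count_nil]
        ring
      rw [hp.nodup_iff, ← hAl, List.nodup_append', List.nodup_append', List.nodup_cons]
      refine ⟨hRnd, ⟨hLnd, ⟨by simpa using hbA, A.nodup_toList⟩, ?_⟩, ?_⟩
      · intro x hx hx'
        rw [hLX] at hx
        rcases List.mem_cons.1 hx' with rfl | hx'
        · exact hbX hx
        · exact Finset.disjoint_left.1 hdisj hx (Finset.mem_toList.1 hx')
      · intro x hx hx'
        rw [hRmem] at hx
        rw [List.mem_append, hLX, List.mem_cons, Finset.mem_toList] at hx'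
        tauto
    · intro x
      rw [List.mem_cons, hmemt, hRmem]
      tauto
    · have := ht.length_eq
      simp only [List.length_append, List.length_cons, List.length_nil] at this ⊢
      omega
  have hsplit : ∀ t : List (Fin n),
      weight σ (c :: (R ++ a₀ :: (interleave L as ++ a :: (t ++ [c])))) =
      weight σ (c :: (R ++ [a₀])) + (weight σ (a₀ :: (interleave L as ++ [a])) +
        weight σ (a :: (t ++ [c]))) := by
    intro t
    exact (weight_append_cons σ (c :: R) a₀ _).trans
      (congrArg _ (weight_append_cons σ (a₀ :: interleave L as) a _))
  obtain ⟨k, hk⟩ := weight_interleave hA L hL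
    (fun P hP x hx => hXA x ((hLX x).1 (List.mem_flatten.2 ⟨P, hP, hx⟩))) a₀ as a
    (by
      have hp : (a₀ :: (as ++ [a])).Perm (a :: a₀ :: as) :=
        List.perm_append_singleton a (a₀ :: as)
      rw [hp.nodup_iff]
      exact hndA.sublist ((List.sublist_cons_self _ _).cons_cons a))
    (fun x hx => (hmemA x).2 (by simp at hx; tauto)) hlen
  have hw1 : weight σ [a, a', b, c] = α + σ s(b, c) := by
    simp [hA a haA a' ha'A haa', hAb a' ha'A]
  have hw2 : weight σ [a, b, a', c] = σ s(b, c) := by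
    rw [weight_cons_cons, weight_cons_cons, weight_cons_cons, Sym2.eq_swap (a := b), hAb a haA,
      hAb a' ha'A, hAc a' ha'A]
    simp
  -- For odd `k` the route avoiding the edge `aa'` compensates for the surplus `α`.
  rcases Nat.even_or_odd k with ⟨j, rfl⟩ | ⟨j, rfl⟩
  · have h := hmain [a', b] (.refl _)
    rw [hsplit, hk, add_smul, vector_add_self, add_zero] at h
    convert h using 1
    simp only [List.cons_append, List.nil_append]
    ring
  · have h := hmain [b, a'] (List.Perm.swap _ _ _)
    rw [hsplit, hk, add_smul, two_mul, add_smul, vector_add_self, zero_add, one_smul] at h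
    convert h using 1
    simp only [List.cons_append, List.nil_append, hw1, hw2]
    ring

end Structure

/-! ### From independent triangles to paths -/

theorem mem_of_mem_triangleEdges {n : ℕ} {T : Finset (Fin n)} {e : Sym2 (Fin n)}
    (he : e ∈ triangleEdges T) {v : Fin n} (hv : v ∈ e) : v ∈ T :=
  Finset.mem_sym2_iff.1 (Finset.mem_filter.1 he).1 v hv

/-- Edges chosen from triangles no three of which share a vertex or form a circle can be arranged
in disjoint paths, with isolated vertices as trivial paths. -/
theorem exists_paths_of_choice {n m : ℕ} {T : Fin m → Finset (Fin n)} (hv : ¬ ShareVertex T)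
    (hc : ¬ FormCircle T) {r : Fin m → Sym2 (Fin n)} (hr : ∀ i, r i ∈ triangleEdges (T i))
    (J : Finset (Fin m)) :
    ∃ L : List (List (Fin n)), (∀ P ∈ L, P ≠ []) ∧ L.flatten.Nodup ∧
      (∀ v, v ∈ L.flatten ↔ v ∈ Finset.univ.biUnion T) ∧
      (L.flatMap edgeList).Perm (J.image r).toList := by
  have hE : ∀ e ∈ J.image r, ∃ i, r i = e := fun e he => by
    obtain ⟨i, -, h⟩ := Finset.mem_image.1 he
    exact ⟨i, h⟩
  refine exists_paths_of_linearForest _ _ ?_ ?_ ?_ ?_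
  · intro e he
    obtain ⟨i, rfl⟩ := hE e he
    exact (Finset.mem_filter.1 (hr i)).2
  · intro e he v hve
    obtain ⟨i, rfl⟩ := hE e he
    exact Finset.mem_biUnion.2 ⟨i, Finset.mem_univ _, mem_of_mem_triangleEdges (hr i) hve⟩
  · intro v
    have h2 : (Finset.univ.filter fun i => v ∈ T i).card < 3 := by
      by_contra h
      exact hv ⟨v, by omega⟩
    have hsub : ((J.image r).filter fun e => v ∈ e) ⊆
        (Finset.univ.filter fun i => v ∈ T i).image r := by
      intro e he
      obtain ⟨he, hve⟩ := Finset.mem_filter.1 he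
      obtain ⟨i, rfl⟩ := hE e he
      exact Finset.mem_image.2 ⟨i, by simpa using mem_of_mem_triangleEdges (hr i) hve, rfl⟩
    have := (Finset.card_le_card hsub).trans Finset.card_image_le
    omega
  · intro v c hcyc
    by_contra! hcon
    have hlen := hcyc.three_le_length
    obtain ⟨e, he⟩ : ∃ e, e ∈ c.edges := by
      refine List.exists_mem_of_length_pos ?_
      rw [SimpleGraph.Walk.length_edges]
      omega
    obtain ⟨i, -⟩ := hE e (hcon e he)
    have : Nonempty (Fin m) := ⟨i⟩
    have hinv : ∀ e ∈ c.edges, r (Function.invFun r e) = e := fun e he =>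
      Function.invFun_eq (hE e (hcon e he))
    -- A circle of chosen edges would make the triangles form a circle: `r` recovers each edge from
    -- its index, so distinct edges get distinct triangles.
    refine hc ⟨v, c, hcyc, Function.invFun r, ?_, ?_⟩
    · intro e he e' he' h
      rw [← hinv e he, ← hinv e' he', h]
    · intro e he
      have := hr (Function.invFun r e)
      rwa [hinv e he] at this

theorem exists_sum_eq_of_linearIndependent {m : ℕ} {v : Fin m → Fin m → ZMod 2}
    (hv : LinearIndependent (ZMod 2) v) (g : Fin m → ZMod 2) :
    ∃ J : Finset (Fin m), ∑ i ∈ J, v i = g := by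
  have hspan := hv.span_eq_top_of_card_eq_finrank' (by simp)
  obtain ⟨x, hx⟩ := (Submodule.mem_span_range_iff_exists_fun (ZMod 2)).1
    (hspan ▸ Submodule.mem_top : g ∈ Submodule.span (ZMod 2) (Set.range v))
  refine ⟨Finset.univ.filter fun i => x i = 1, ?_⟩
  rw [← hx, Finset.sum_filter]
  refine Finset.sum_congr rfl fun i _ => ?_
  have h01 : ∀ y : ZMod 2, y = 0 ∨ y = 1 := by decide
  rcases h01 (x i) with h | h <;> simp [h]

/-! ### The homogeneous set -/

/-- After suitable switching, there is a large homogeneous set whose edges to a given small set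
have label zero, together with an edge that lies in many triangles of multisign zero. -/
theorem exists_switch_homogeneous (m k K : ℕ) :
    ∃ N : ℕ, ∀ n : ℕ, N ≤ n → ∀ σ : Multisigning n m, (∀ t, eta σ t ≤ eta σ 0) →
      ∀ X : Finset (Fin n), X.card ≤ k →
        ∃ (f : Fin n → Fin m → ZMod 2) (A : Finset (Fin n)) (b c : Fin n) (α : Fin m → ZMod 2),
          b ≠ c ∧ b ∉ X ∧ c ∉ X ∧ b ∉ A ∧ c ∉ A ∧ Disjoint X A ∧ K ≤ A.card ∧
          (∀ x ∈ A, ∀ y ∈ A, x ≠ y → switch f σ s(x, y) = α) ∧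
          (∀ x ∈ X, ∀ a ∈ A, switch f σ s(x, a) = 0) ∧
          (∀ a ∈ A, switch f σ s(a, b) = 0) ∧
          ∀ a ∈ A, switch f σ s(a, c) = switch f σ s(b, c) := by
  obtain ⟨M, hM⟩ := exists_homogeneous_of_sum (C := Fin m → ZMod 2) _ (fun _ => K) rfl
  -- There are at most `(2 ^ m) ^ k` patterns of labels towards `X`, so `M` apexes share one
  -- pattern.
  obtain ⟨N, hN⟩ := exists_edge_in_many_zero_triangles m k ((2 ^ m) ^ k * M)
  refine ⟨N, fun n hn σ hη X hX => ?_⟩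
  obtain ⟨b, c, hbc, hbX, hcX, hF⟩ := hN n hn σ hη X hX
  set F : Finset (Fin n) := Finset.univ.filter fun a =>
    a ∉ X ∧ a ≠ b ∧ a ≠ c ∧ triangleSign σ {a, b, c} = 0
  have hcardX : (Finset.univ : Finset (X → Fin m → ZMod 2)).card * M ≤ F.card := by
    refine le_trans (Nat.mul_le_mul_right _ ?_) hF
    simp only [Finset.card_univ, Fintype.card_fun, ZMod.card, Fintype.card_fin, Fintype.card_coe]
    exact Nat.pow_le_pow_right (by positivity) hX
  obtain ⟨κ, -, hκ⟩ := Finset.exists_le_card_fiber_of_mul_le_card_of_maps_to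
    (f := fun (a : Fin n) (x : X) => σ s((x : Fin n), a) + σ s(b, a))
    (fun _ _ => Finset.mem_univ _) Finset.univ_nonempty hcardX
  -- On the apexes `f` cancels the labels towards `b`; the common pattern `κ` then allows one value
  -- per vertex of `X` to cancel all its labels towards them. Ramsey's theorem is applied to the
  -- switched labels.
  set f : Fin n → Fin m → ZMod 2 := fun u =>
    if h : u ∈ X then κ ⟨u, h⟩ else if u = b ∨ u = c then 0 else σ s(b, u) with hf
  obtain ⟨α, A, hAF, hAK, hA⟩ := hM _ (switch f σ) hκ
  have hmem : ∀ a ∈ A, (a ∉ X ∧ a ≠ b ∧ a ≠ c ∧ triangleSign σ {a, b, c} = 0) ∧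
      ∀ x (hx : x ∈ X), σ s(x, a) + σ s(b, a) = κ ⟨x, hx⟩ := fun a ha => by
    obtain ⟨h1, h2⟩ := Finset.mem_filter.1 (hAF ha)
    exact ⟨(Finset.mem_filter.1 h1).2, fun x hx => congrFun h2 ⟨x, hx⟩⟩
  have hfa : ∀ a ∈ A, f a = σ s(b, a) := fun a ha => by
    obtain ⟨⟨h1, h2, h3, -⟩, -⟩ := hmem a ha
    simp [hf, h1, h2, h3]
  have hfb : f b = 0 := by simp [hf, hbX]
  have hfc : f c = 0 := by simp [hf, hcX]
  have hAb : ∀ a ∈ A, switch f σ s(a, b) = 0 := fun a ha => by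
    rw [switch_mk, hfa a ha, hfb, add_zero, Sym2.eq_swap, vector_add_self]
  refine ⟨f, A, b, c, α, hbc, hbX, hcX, fun h => (hmem b h).1.2.1 rfl,
    fun h => (hmem c h).1.2.2.1 rfl,
    Finset.disjoint_right.2 fun a ha => (hmem a ha).1.1, hAK, hA, ?_, hAb, ?_⟩
  · intro x hx a ha
    have hfx : f x = κ ⟨x, hx⟩ := by simp [hf, hx]
    rw [switch_mk, hfx, hfa a ha, ← (hmem a ha).2 x hx]
    linear_combination vector_add_self (σ s(x, a)) + vector_add_self (σ s(b, a))
  · intro a ha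
    obtain ⟨⟨-, hab, hac, h0⟩, -⟩ := hmem a ha
    have hT : ({a, b, c} : Finset (Fin n)).card = 3 :=
      Finset.card_eq_three.2 ⟨a, b, c, hab, hac, hbc, rfl⟩
    rw [← triangleSign_switch f σ hT, triangleSign_triple _ hab hac hbc, hAb a ha] at h0
    linear_combination h0 - vector_add_self (switch f σ s(b, c))

/-- Along a walk the switching terms telescope to the values at its two ends, which cancel when the
walk is closed. -/
theorem hamiltonianMultisigns_switch_subset {n m : ℕ} (f : Fin n → Fin m → ZMod 2)
    (σ : Multisigning n m) : hamiltonianMultisigns (switch f σ) ⊆ hamiltonianMultisigns σ := by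
  rintro g ⟨v, p, hp, rfl⟩
  refine ⟨v, p, hp, ?_⟩
  rw [multisign, multisign, List.sum_toFinset _ hp.isCycle.edges_nodup,
    List.sum_toFinset _ hp.isCycle.edges_nodup]
  have key : ∀ {u w : Fin n} (q : (K n).Walk u w),
      (q.edges.map (switch f σ)).sum = (q.edges.map σ).sum + (f u + f w) := by
    intro u w q
    induction q with
    | nil => simp [vector_add_self]
    | @cons u x w h q ih =>
      simp only [SimpleGraph.Walk.edges_cons, List.map_cons, List.sum_cons, ih, switch_mk]
      linear_combination vector_add_self (f x)
  rw [key, vector_add_self, add_zero]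

end Multisigned

theorem theorem1 (m : ℕ) :
    ∃ N : ℕ, ∀ n : ℕ, N ≤ n → ∀ σ : Multisigned.Multisigning n m,
      (∀ t : Fin m → ZMod 2, Multisigned.eta σ t ≤ Multisigned.eta σ 0) →
      (∃ T : Fin m → Finset (Fin n), Multisigned.IndependentTriangles σ T) →
      ¬ Multisigned.IsSpecial σ →
      Multisigned.hamiltonianMultisigns σ = Set.univ := by
  open Multisigned in
  obtain ⟨N, hN⟩ := exists_switch_homogeneous m (m * 3) (m * 3 + 3)
  refine ⟨N, fun n hn σ hη _ hspecial => Set.eq_univ_of_forall fun g => ?_⟩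
  simp only [IsSpecial, not_forall, not_or] at hspecial
  obtain ⟨T, ⟨hT3, hTind⟩, hv, hc⟩ := hspecial
  have hX : (Finset.univ.biUnion T).card ≤ m * 3 := by
    simpa using Finset.card_biUnion_le_card_mul Finset.univ T 3 fun i _ => (hT3 i).le
  obtain ⟨f, A, b, c, α, hbc, hbX, hcX, hbA, hcA, hdisj, hcard, hA, hXA, hAb, hAc⟩ :=
    hN n hn σ hη _ hX
  obtain ⟨d, hd⟩ := exists_add_sum_mem_hamiltonianMultisigns (switch f σ) _ A b c α hbc hbX hcX
    hbA hcA hdisj (by omega) hA hXA hAb hAc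
  -- Triangle multisigns survive switching, so the edges can be chosen by their switched labels.
  have hind : LinearIndependent (ZMod 2) fun i => ∑ e ∈ triangleEdges (T i), switch f σ e := by
    have h : (fun i => ∑ e ∈ triangleEdges (T i), switch f σ e) =
        fun i => triangleSign σ (T i) := funext fun i => triangleSign_switch f σ (hT3 i)
    rwa [h]
  obtain ⟨r, hr, hrind⟩ := exists_linearIndependent_of_sum _ _ hind
  have hinj : Function.Injective r := Function.Injective.of_comp (f := switch f σ) hrind.injective
  -- The constant `d` was fixed before the paths, so aiming at `d + g` makes it cancel.
  obtain ⟨J, hJ⟩ := exists_sum_eq_of_linearIndependent hrind (d + g)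
  obtain ⟨L, hL, hLnd, hLX, hLE⟩ := exists_paths_of_choice hv hc hr J
  have hsum : (L.map (weight (switch f σ))).sum = d + g := by
    have h := (hLE.map (switch f σ)).sum_eq
    rw [Finset.sum_map_toList, Finset.sum_image fun _ _ _ _ h => hinj h, hJ] at h
    rw [← h]
    clear h hLE hLnd hLX hL
    induction L with
    | nil => rfl
    | cons P L ih => simp [ih, weight]
  have h := hd L hL hLnd hLX
  rw [hsum, ← add_assoc, vector_add_self, zero_add] at h
  exact hamiltonianMultisigns_switch_subset f σ h
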